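/- **Notation.** Let $\mathcal X$ be the set of pairs of coprime positive integers, and $|(x,y)|=x+y$. Each $v\in\mathcal X$ is uniquely $v=v^-+v^+$ with $v^-=(a,b)$, $v^+=(c,d)\in\mathbb N^2$ and $ad-bc=1$. Of the vectors $v^\pm$, $M(v)$ denotes the longer one and $F(v)$ the other one (for $v=(1,1)$ both have length $1$). Let $a_0=0$, $a_1=1$, $a_{k+1}=a_k+a_{k-1}$; let $f_k=a_{k+1}$ for $k>0$ and $f_k=0$ for $k\le 0$. Put $|v|_k=a_{k+2}|M(v)|+a_{k+1}|F(v)|$, $C(R,k)=\{v\in\mathcal X: |v|_k\le R\}$ and $M(R)=\max\{k: f_k\le R\}$. Let $\mathcal F$ be the set of Fibonadic numbers, that is, of the sequences $z=(z_i)\in\{0,1\}^{\mathbb Z}$ with $z_i=0$ for $i\gg0$ and $z_iz_{i-1}=0$ for all $i$, ordered by: $z<z'$ if $z_i=0$, $z'_i=1$ at the largest index $i$ where they differ. Call $z$ finite if it has finitely many nonzero digits; for finite $z\ne0$ with lowest nonzero digit at index $n_0$, let $z^-$ have the digits $z_i$ for $i>n_0$, and for $i\le n_0$ the digit $0$ if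 $i\equiv n_0 \pmod 2$ and $1$ otherwise. Let $1$ and $\Phi$ be the sequences whose only nonzero digit is at index $0$, respectively $1$. The principal units are $\mathcal D=\{z\in\mathcal F: z_0=1,\ z_i=0 \text{ for } i>0\}$. For $z\in\mathcal F$ put $R^z_m=\sum_j z_jf_{m+j}$, let $$b(n,z)=\{v\in\mathcal X : v\in C(R^z_m,\,M(R^z_m)-n-1)\ \text{ for all sufficiently large } m\},$$ and let $B(n)=\{b(n,z): z\in\mathcal D\}$. The restriction map $r$ sends a set $c\subseteq\mathcal X$ to the set of its branching points $\{v\in c: v+v^+\in c,\ v+v^-\in c\}$. **Statement.** (1) For every $n\ge 0$ the set $B(n)$ is finite, and there are unique finite Fibonadic numbers $$1=z^n_0<z^n_1<\dots<z^n_{\#B(n)}=\Phi$$ such that for all $z\in\mathcal D$ and $0\le k<\#B(n)$: $$z^n_k\le z\le (z^n_{k+1})^-\iff b(n,z^n_k)=b(n,z)=b\bigl(n,(z^n_{k+1})^-\bigr).$$ (2) For all such $n$, $k$ and $z$, also $z^n_k\le z\le (z^n_{k+1})^-$ if and only if $b(n,z)=b(n,z^n_k)$. (3) For every $n\ge1$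 and $z\in\mathcal D$ we have $r\,b(n,z)=b(n-1,z)$; in particular $r$ maps $B(n)$ to $B(n-1)$. (4) For every $n\ge 1$ we have $\{z^{n-1}_j\}_j\subseteq\{z^n_k\}_k$; and for $0\le k<\#B(n)$, $0\le j<\#B(n-1)$ and $z\in\mathcal D$ with $z^n_k\le z\le (z^n_{k+1})^-$, $$r\,b(n,z)=b(n-1,z)=b(n-1,z^{n-1}_j)\iff [z^n_k,(z^n_{k+1})^-]\subseteq[z^{n-1}_j,(z^{n-1}_{j+1})^-].$$ -/

import Mathlib

namespace FareyFib

/-! ### The Farey tree -/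

/-- The set `𝒳` of pairs of coprime positive integers. -/
abbrev Vertex : Type := {p : ℕ × ℕ // 0 < p.1 ∧ 0 < p.2 ∧ Nat.Coprime p.1 p.2}

/-- `IsBounds v l u`: the matrix with rows `l`, `u` lies in `SL₂(ℕ)` and `v = (1,1) · (l ; u)`. -/
def IsBounds (v l u : ℕ × ℕ) : Prop :=
  l.1 * u.2 = l.2 * u.1 + 1 ∧ l + u = v

theorem exists_isBounds (v : Vertex) : ∃ q : (ℕ × ℕ) × (ℕ × ℕ), IsBounds v.1 q.1 q.2 := by
  obtain ⟨⟨x, y⟩, hx, hy, hc⟩ := v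
  simp only at hx hy hc
  induction hN : x + y using Nat.strong_induction_on generalizing x y with
  | _ N ih =>
    rcases lt_trichotomy x y with h | h | h
    · obtain ⟨⟨⟨a, b⟩, ⟨c, d⟩⟩, h1, h2⟩ := ih (x + (y - x)) (by omega) x (y - x) hx (by omega)
        ((Nat.coprime_sub_self_right h.le).2 hc) rfl
      simp only [Prod.mk_add_mk, Prod.mk.injEq] at h1 h2
      refine ⟨⟨⟨a, b + a⟩, ⟨c, d + c⟩⟩, ?_, ?_⟩
      · simp only; nlinarith
      · simp only [Prod.mk_add_mk, Prod.mk.injEq]; omega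
    · subst h
      have : x = 1 := by simpa using hc
      subst this
      exact ⟨⟨⟨1, 0⟩, ⟨0, 1⟩⟩, by simp [IsBounds]⟩
    · obtain ⟨⟨⟨a, b⟩, ⟨c, d⟩⟩, h1, h2⟩ := ih ((x - y) + y) (by omega) (x - y) y (by omega) hy
        ((Nat.coprime_sub_self_left h.le).2 hc) rfl
      simp only [Prod.mk_add_mk, Prod.mk.injEq] at h1 h2
      refine ⟨⟨⟨a + b, b⟩, ⟨c + d, d⟩⟩, ?_, ?_⟩
      · simp only; nlinarith
      · simp only [Prod.mk_add_mk, Prod.mk.injEq]; omega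

/-- The bounds are unique, so that `lower` and `upper` below are well defined. -/
theorem IsBounds.unique {v l u l' u' : ℕ × ℕ} (hv : 0 < v.1 ∧ 0 < v.2)
    (h : IsBounds v l u) (h' : IsBounds v l' u') : l = l' ∧ u = u' := by
  obtain ⟨a, b⟩ := l
  obtain ⟨c, d⟩ := u
  obtain ⟨a', b'⟩ := l'
  obtain ⟨c', d'⟩ := u'
  obtain ⟨x, y⟩ := v
  obtain ⟨h1, h2⟩ := h
  obtain ⟨h1', h2'⟩ := h'
  simp only [Prod.mk_add_mk, Prod.mk.injEq] at *
  obtain ⟨rfl, rfl⟩ := h2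
  obtain ⟨h3, h4⟩ := h2'
  obtain ⟨hx, hy⟩ := hv
  have e1 : a * (b + d) = b * (a + c) + 1 := by nlinarith
  have e2 : a' * (b + d) = b' * (a + c) + 1 := by rw [← h3, ← h4]; nlinarith
  zify at *
  have e3 : ((a : ℤ) - a') * (b + d) = (b - b') * (a + c) := by linarith
  have hcop : IsCoprime ((a : ℤ) + c) (b + d) := ⟨-b, a, by linarith⟩
  have hdvd : ((a : ℤ) + c) ∣ (a - a') :=
    hcop.dvd_of_dvd_mul_right ⟨b - b', by rw [e3]; ring⟩
  have hapos : (0 : ℤ) < a := by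
    rcases Nat.eq_zero_or_pos a with h | h
    · subst h; push_cast at *; nlinarith [mul_nonneg (Int.natCast_nonneg b) (Int.natCast_nonneg c)]
    · exact_mod_cast h
  have hapos' : (0 : ℤ) < a' := by
    rcases Nat.eq_zero_or_pos a' with h | h
    · subst h
      push_cast at *
      nlinarith [mul_nonneg (Int.natCast_nonneg b') (Int.natCast_nonneg c')]
    · exact_mod_cast h
  have haa : (a : ℤ) - a' = 0 := by
    apply Int.eq_zero_of_abs_lt_dvd hdvd
    rw [abs_lt]
    constructor <;> linarith [Int.natCast_nonneg c, Int.natCast_nonneg c']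
  have hbb : (b : ℤ) - b' = 0 := by
    rw [haa, zero_mul] at e3
    rcases mul_eq_zero.1 e3.symm with h | h
    · exact h
    · linarith
  omega

/-- The lower bound `v⁻` of `v`. -/
noncomputable def lower (v : Vertex) : ℕ × ℕ := (exists_isBounds v).choose.1

/-- The upper bound `v⁺` of `v`. -/
noncomputable def upper (v : Vertex) : ℕ × ℕ := (exists_isBounds v).choose.2

theorem isBounds (v : Vertex) : IsBounds v.1 (lower v) (upper v) :=
  (exists_isBounds v).choose_spec

/-- The length `|(x,y)| = x + y`. -/
def len (p : ℕ × ℕ) : ℕ := p.1 + p.2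

/-- The mother `M(v)`: the longer one of the two bounds. At the root `(1,1)` both bounds have
length `1`, and only the lengths of `mother` and `father` are used. -/
noncomputable def mother (v : Vertex) : ℕ × ℕ :=
  if len (lower v) < len (upper v) then upper v else lower v

/-- The father `F(v)`: the other bound. -/
noncomputable def father (v : Vertex) : ℕ × ℕ :=
  if len (lower v) < len (upper v) then lower v else upper v

/-- The descendant `v + v⁺` of `v`. -/
noncomputable def upperChild (v : Vertex) : Vertex :=
  ⟨v.1 + upper v, Nat.add_pos_left v.2.1 _, Nat.add_pos_left v.2.2.1 _, by
    obtain ⟨h1, h2⟩ := isBounds v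
    rw [← h2]
    rw [Nat.coprime_iff_isRelPrime, ← Nat.isCoprime_iff_coprime.trans Nat.coprime_iff_isRelPrime]
    zify at h1
    refine ⟨-((lower v).2 + (upper v).2 : ℤ), (lower v).1 + (upper v).1, ?_⟩
    simp only [Prod.fst_add, Prod.snd_add]
    push_cast
    linear_combination h1⟩

/-- The descendant `v + v⁻` of `v`. -/
noncomputable def lowerChild (v : Vertex) : Vertex :=
  ⟨v.1 + lower v, Nat.add_pos_left v.2.1 _, Nat.add_pos_left v.2.2.1 _, by
    obtain ⟨h1, h2⟩ := isBounds v
    rw [← h2]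
    rw [Nat.coprime_iff_isRelPrime, ← Nat.isCoprime_iff_coprime.trans Nat.coprime_iff_isRelPrime]
    zify at h1
    refine ⟨((lower v).2 + (upper v).2 : ℤ), -((lower v).1 + (upper v).1), ?_⟩
    simp only [Prod.fst_add, Prod.snd_add]
    push_cast
    linear_combination h1⟩

/-- The set of branching points of `c`: the vertices of `c` both of whose descendants lie in `c`.
On configurations this is the restriction map `r : B(n) → B(n-1)`, which removes the top layer. -/
def branching (c : Set Vertex) : Set Vertex :=
  {v | v ∈ c ∧ upperChild v ∈ c ∧ lowerChild v ∈ c}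

/-- `|v|_k = a_{k+2} |M(v)| + a_{k+1} |F(v)|`, with `a` the Fibonacci numbers. -/
noncomputable def vnorm (k : ℕ) (v : Vertex) : ℕ :=
  Nat.fib (k + 2) * len (mother v) + Nat.fib (k + 1) * len (father v)

/-- `C(R,k) = {v | |v|_k ≤ R}`. -/
def farey (R k : ℕ) : Set Vertex := {v | vnorm k v ≤ R}

/-- The numbers `f_i`: `0` for `i ≤ 0`, and `f_1 = 1`, `f_2 = 2`, `f_3 = 3`, `f_4 = 5`, … -/
def f (i : ℤ) : ℕ := if 0 < i then Nat.fib (i.toNat + 1) else 0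

/-- `M(R) = max {k | f_k ≤ R}`; every such `k` is at most `R`, as `k ≤ f_k`. -/
def maxIndex (R : ℕ) : ℕ := Nat.findGreatest (fun k => f k ≤ R) R

/-- The base `b(n,R) = C(R, M(R) - n - 1)` (used for `R` large with respect to `n`). -/
def baseNat (n R : ℕ) : Set Vertex := farey R (maxIndex R - n - 1)

/-! ### Fibonadic numbers -/

/-- A Fibonadic number: a two-sided sequence of digits `0`, `1`, without consecutive `1`s, and
zero at all large indices. -/
@[ext]
structure Fibonadic where
  digit : ℤ → ℕ
  digit_le_one : ∀ i, digit i ≤ 1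
  eventually_zero : ∃ N, ∀ i, N < i → digit i = 0
  no_consecutive : ∀ i, digit i * digit (i - 1) = 0

namespace Fibonadic

/-- `z < z'` if at the largest index at which they differ, `z` has digit `0` and `z'` has
digit `1`. -/
protected def Lt (z w : Fibonadic) : Prop :=
  ∃ i, z.digit i = 0 ∧ w.digit i = 1 ∧ ∀ j, i < j → z.digit j = w.digit j

theorem lt_irrefl' (z : Fibonadic) : ¬ z.Lt z := by
  rintro ⟨i, h0, h1, -⟩
  omega

theorem lt_trans' {x y z : Fibonadic} (h : x.Lt y) (h' : y.Lt z) : x.Lt z := by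
  obtain ⟨i, a0, a1, a⟩ := h
  obtain ⟨j, b0, b1, b⟩ := h'
  rcases lt_trichotomy i j with hij | rfl | hij
  · exact ⟨j, by rw [a j hij, b0], b1, fun k hk => by rw [a k (hij.trans hk), b k hk]⟩
  · omega
  · exact ⟨i, a0, by rw [← b i hij, a1], fun k hk => by rw [a k hk, b k (hij.trans hk)]⟩

theorem lt_total' {x y : Fibonadic} (h : x ≠ y) : x.Lt y ∨ y.Lt x := by
  obtain ⟨N, hN⟩ := x.eventually_zero
  obtain ⟨N', hN'⟩ := y.eventually_zero
  have hex : ∃ i, x.digit i ≠ y.digit i := by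
    by_contra! hc
    exact h (Fibonadic.ext (funext hc))
  obtain ⟨i, hi, hmax⟩ := Int.exists_greatest_of_bdd (P := fun i => x.digit i ≠ y.digit i)
    ⟨max N N', fun z hz => by
      by_contra! hc
      exact hz (by rw [hN z (by omega), hN' z (by omega)])⟩ hex
  have heq : ∀ j, i < j → x.digit j = y.digit j := fun j hj => by
    by_contra hc
    have := hmax j hc
    omega
  have hx := x.digit_le_one i
  have hy := y.digit_le_one i
  rcases Nat.lt_or_gt_of_ne hi with hlt | hlt
  · exact Or.inl ⟨i, by omega, by omega, heq⟩
  · exact Or.inr ⟨i, by omega, by omega, fun j hj => (heq j hj).symm⟩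

noncomputable instance : LinearOrder Fibonadic where
  lt := Fibonadic.Lt
  le x y := x = y ∨ x.Lt y
  le_refl x := Or.inl rfl
  le_trans x y z h h' := by
    rcases h with rfl | h
    · exact h'
    · rcases h' with rfl | h'
      · exact Or.inr h
      · exact Or.inr (lt_trans' h h')
  lt_iff_le_not_ge x y := by
    constructor
    · refine fun h => ⟨Or.inr h, ?_⟩
      rintro (rfl | h')
      · exact lt_irrefl' _ h
      · exact lt_irrefl' _ (lt_trans' h h')
    · rintro ⟨rfl | h, h'⟩
      · exact absurd (Or.inl rfl) h'
      · exact h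
  le_antisymm x y h h' := by
    rcases h with rfl | h
    · rfl
    · rcases h' with rfl | h'
      · rfl
      · exact absurd (lt_trans' h h') (lt_irrefl' _)
  le_total x y := by
    by_cases h : x = y
    · exact Or.inl (Or.inl h)
    · rcases lt_total' h with h | h
      · exact Or.inl (Or.inr h)
      · exact Or.inr (Or.inr h)
  toDecidableLE := Classical.decRel _

/-- The number `Φ^k`, whose only nonzero digit is a `1` at index `k`. -/
def phiPow (k : ℤ) : Fibonadic where
  digit i := if i = k then 1 else 0
  digit_le_one i := by split_ifs <;> simp
  eventually_zero := ⟨k, fun i hi => by simp [hi.ne']⟩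
  no_consecutive i := by
    split_ifs with h1 h2
    · omega
    all_goals simp

/-- Finite Fibonadic numbers: only finitely many digits are nonzero. -/
def IsFin (z : Fibonadic) : Prop := ∃ N : ℤ, ∀ i, N < i → z.digit i = 0 ∧ z.digit (-i) = 0

open Classical in
/-- The number `z⁻`, for a finite nonzero `z`: if `n₀` is the least index with digit `1`, keep the
digits above `n₀` and continue with `0 1 0 1 0 1 …` from the index `n₀` downwards. (If there is no
least index with digit `1`, that is, if `z` is zero or not finite, the value is `z`.) -/
noncomputable def minus (z : Fibonadic) : Fibonadic :=
  if h : ∃ n₀, IsLeast {i | z.digit i = 1} n₀ then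
    { digit := fun i => if h.choose < i then z.digit i else if Even (i - h.choose) then 0 else 1
      digit_le_one := fun i => by
        have := z.digit_le_one i
        split_ifs <;> simp [this]
      eventually_zero := by
        obtain ⟨N, hN⟩ := z.eventually_zero
        refine ⟨max N h.choose, fun i hi => ?_⟩
        rw [if_pos (by omega), hN i (by omega)]
      no_consecutive := fun i => by
        have h1 : z.digit h.choose = 1 := h.choose_spec.1
        have h2 := z.no_consecutive i
        generalize h.choose = n at *
        rcases lt_trichotomy i (n + 1) with hi | rfl | hi
        · rw [if_neg (show ¬ n < i by omega), if_neg (show ¬ n < i - 1 by omega)]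
          split_ifs with e1 e2
          · simp
          · simp
          · simp
          · exfalso
            rw [Int.not_even_iff] at e1
            rename_i e2
            rw [Int.not_even_iff] at e2
            omega
        · simp
        · rw [if_pos (show n < i by omega), if_pos (show n < i - 1 by omega), h2] }
  else z

/-- The coherent sequence of `z`: `R^z_m = ∑_j z_j f_{m+j}`; only finitely many terms of the
sum are nonzero. -/
noncomputable def rep (z : Fibonadic) (m : ℕ) : ℕ := ∑ᶠ j : ℤ, z.digit j * f (m + j)

end Fibonadic

/-- The principal units `𝒟`. -/
def principalUnits : Set Fibonadic := {z | z.digit 0 = 1 ∧ ∀ i, 0 < i → z.digit i = 0}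

/-- The base `b(n,z)`: the vertices that lie in `b(n, R^z_m)` for all large `m`. -/
def base (n : ℕ) (z : Fibonadic) : Set Vertex :=
  {v | ∀ᶠ m in Filter.atTop, v ∈ baseNat n (z.rep m)}

/-- The set `B(n)` of configurations of height `n`. -/
def configs (n : ℕ) : Set (Set Vertex) := base n '' principalUnits

/-- `c 0, c 1, …, c (#B(n))` are breakpoints at level `n`: finite Fibonadic numbers with
`1 = c 0 < c 1 < … < c (#B(n)) = Φ` such that a principal unit `z` satisfies
`c k ≤ z ≤ (c (k+1))⁻` if and only if `b(n, c k) = b(n, z) = b(n, (c (k+1))⁻)`. -/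
structure IsBreakpoints (n : ℕ) (c : Fin ((configs n).ncard + 1) → Fibonadic) : Prop where
  isFin : ∀ k, (c k).IsFin
  strictMono : StrictMono c
  first : c 0 = Fibonadic.phiPow 0
  last : c (Fin.last _) = Fibonadic.phiPow 1
  mem_iff : ∀ k : Fin (configs n).ncard, ∀ z ∈ principalUnits,
    (c k.castSucc ≤ z ∧ z ≤ (c k.succ).minus) ↔
      (base n (c k.castSucc) = base n z ∧ base n z = base n (c k.succ).minus)

end FareyFib

namespace FareyFib

/-! ### Bounds and norms of the descendants -/

/-! For fixed `n`, membership of a vertex in `base n z` is a threshold condition on `z`. A principal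
unit has leading digit at index `0`, so `R^z_m` lies between `f_m` and `f_{m+1}`, and `v` belongs to
`base n z` when `f_{m-n} |M(v)| + f_{m-n-1} |F(v)| ≤ R^z_m` for large `m`. Fibonacci carrying turns
the left side into `R^w_m` for one finite Fibonadic `w`, and eventual comparison of the `R_m` is the
order on Fibonadic numbers; hence the condition reads `w ≤ z` (`exists_threshold`).

Only finitely many vertices occur, so `base n` is an increasing step function on `𝒟` with finitely
many jumps, all at finite numbers. Its fibres are intervals; their minima together with `Φ` are the
breakpoints, and `z⁻` is the immediate predecessor of `z`, which closes the intervals on the right.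
A count of `#B(n)` intervals against `#B(n)` values gives uniqueness.

Restriction comes from `vnorm_succ_eq_max`. As it makes `base n` a function of `base (n + 1)`,
breakpoints persist when the height grows. -/

theorem bounds_eq {v : Vertex} {l u : ℕ × ℕ} (h : IsBounds v.1 l u) :
    lower v = l ∧ upper v = u :=
  (isBounds v).unique ⟨v.2.1, v.2.2.1⟩ h

theorem bounds_upperChild (v : Vertex) :
    lower (upperChild v) = v.1 ∧ upper (upperChild v) = upper v := by
  obtain ⟨h1, h2⟩ := isBounds v
  refine bounds_eq ⟨?_, rfl⟩
  rw [← h2]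
  simp only [Prod.fst_add, Prod.snd_add]
  linarith

theorem bounds_lowerChild (v : Vertex) :
    lower (lowerChild v) = lower v ∧ upper (lowerChild v) = v.1 := by
  obtain ⟨h1, h2⟩ := isBounds v
  refine bounds_eq ⟨?_, add_comm _ _⟩
  rw [← h2]
  simp only [Prod.fst_add, Prod.snd_add]
  linarith

theorem len_eq_add (v : Vertex) : len v.1 = len (lower v) + len (upper v) := by
  rw [← (isBounds v).2]
  simp only [len, Prod.fst_add, Prod.snd_add]
  ring

theorem vnorm_eq (k : ℕ) (v : Vertex) :
    vnorm k v = Nat.fib (k + 2) * max (len (lower v)) (len (upper v)) +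
      Nat.fib (k + 1) * min (len (lower v)) (len (upper v)) := by
  unfold vnorm mother father
  split_ifs with h
  · rw [max_eq_right h.le, min_eq_left h.le]
  · rw [max_eq_left (not_lt.1 h), min_eq_right (not_lt.1 h)]

theorem vnorm_upperChild (k : ℕ) (v : Vertex) :
    vnorm k (upperChild v) = Nat.fib (k + 2) * len v.1 + Nat.fib (k + 1) * len (upper v) := by
  rw [vnorm_eq, (bounds_upperChild v).1, (bounds_upperChild v).2,
    max_eq_left (by rw [len_eq_add]; omega), min_eq_right (by rw [len_eq_add]; omega)]

theorem vnorm_lowerChild (k : ℕ) (v : Vertex) :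
    vnorm k (lowerChild v) = Nat.fib (k + 2) * len v.1 + Nat.fib (k + 1) * len (lower v) := by
  rw [vnorm_eq, (bounds_lowerChild v).1, (bounds_lowerChild v).2,
    max_eq_right (by rw [len_eq_add]; omega), min_eq_left (by rw [len_eq_add]; omega)]

theorem vnorm_le_vnorm_succ (k : ℕ) (v : Vertex) : vnorm k v ≤ vnorm (k + 1) v := by
  unfold vnorm
  gcongr <;> omega

/-- With `M`, `F` the lengths of the bounds, `a_{k+3} M + a_{k+2} F = a_{k+2} (M + F) + a_{k+1} M`,
which is the norm of the child that retains the longer bound. This identity is the source of the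
restriction map. -/
theorem vnorm_succ_eq_max (k : ℕ) (v : Vertex) :
    vnorm (k + 1) v = max (vnorm k (upperChild v)) (vnorm k (lowerChild v)) := by
  rw [vnorm_upperChild, vnorm_lowerChild, vnorm_eq, len_eq_add,
    show k + 1 + 2 = k + 1 + 1 + 1 from rfl, show k + 2 = k + 1 + 1 from rfl,
    Nat.fib_add_two (n := k + 1)]
  rcases le_total (len (lower v)) (len (upper v)) with h | h
  · rw [max_eq_right h, min_eq_left h, max_eq_left (by gcongr)]
    ring
  · rw [max_eq_left h, min_eq_right h, max_eq_right (by gcongr)]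
    ring

theorem len_mother_add_len_father (v : Vertex) :
    len (mother v) + len (father v) = len v.1 := by
  rw [len_eq_add]
  unfold mother father
  split_ifs <;> omega

theorem len_le_two_mul_len_mother (v : Vertex) : len v.1 ≤ 2 * len (mother v) := by
  rw [← len_mother_add_len_father]
  unfold mother father
  split_ifs <;> omega

theorem finite_len_le (N : ℕ) : {v : Vertex | len v.1 ≤ N}.Finite := by
  refine Set.Finite.of_finite_image
    (((Set.finite_Iic N).prod (Set.finite_Iic N)).subset ?_) Subtype.val_injective.injOn
  rintro _ ⟨v, hv, rfl⟩
  simp only [Set.mem_ofPred_eq, len] at hv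
  exact ⟨by simp only [Set.mem_Iic]; omega, by simp only [Set.mem_Iic]; omega⟩

/-! ### Zeckendorf sums -/

theorem f_of_pos {i : ℤ} {n : ℕ} (h : i = n) (hn : 0 < n) : f i = Nat.fib (n + 1) := by
  subst h
  simp [f, hn]

theorem f_of_nonpos {i : ℤ} (h : i ≤ 0) : f i = 0 := by
  simp [f, not_lt.2 h]

/-- A sum of nonconsecutive Fibonacci numbers is less than the next Fibonacci number. -/
theorem sum_fib_lt (d : ℕ → ℕ) (hd : ∀ p, d p ≤ 1) (hc : ∀ p, d (p + 1) * d p = 0) (L : ℕ) :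
    ∑ p ∈ Finset.range L, d p * Nat.fib (p + 2) < Nat.fib (L + 2) := by
  induction L using Nat.strong_induction_on with
  | _ L ih =>
    match L with
    | 0 => simp
    | 1 =>
      have := hd 0
      simp only [Finset.range_one, Finset.sum_singleton]
      norm_num [Nat.fib]
      omega
    | L + 2 =>
      rw [Finset.sum_range_succ]
      have h1 := ih (L + 1) (by omega)
      have h0 := ih L (by omega)
      have e1 : Nat.fib (L + 2 + 2) = Nat.fib (L + 2) + Nat.fib (L + 1 + 2) :=
        Nat.fib_add_two (n := L + 2)
      have hL := hd (L + 1)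
      rcases Nat.le_one_iff_eq_zero_or_eq_one.1 hL with h | h
      · rw [h]; omega
      · have hz : d L = 0 := by simpa [h] using hc L
        rw [Finset.sum_range_succ, hz, h]
        omega

namespace Fibonadic

theorem lt_def {z w : Fibonadic} :
    z < w ↔ ∃ i, z.digit i = 0 ∧ w.digit i = 1 ∧ ∀ j, i < j → z.digit j = w.digit j :=
  Iff.rfl

/-- The substitution `p = m + j - 1` makes the sum an ordinary Zeckendorf sum: digits with `m + j ≤
0` drop out because `f` vanishes there. -/
theorem rep_eq_sum (z : Fibonadic) (m L : ℕ) (h : ∀ j : ℤ, (L : ℤ) < m + j → z.digit j = 0) :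
    z.rep m = ∑ p ∈ Finset.range L, z.digit (p + 1 - m) * Nat.fib (p + 2) := by
  have hinj : Function.Injective (fun p : ℕ => (p : ℤ) + 1 - m) := fun a b hab => by
    simp only at hab; omega
  rw [rep, finsum_eq_sum_of_support_subset (s := (Finset.range L).map ⟨_, hinj⟩), Finset.sum_map]
  · refine Finset.sum_congr rfl fun p _ => ?_
    simp only [Function.Embedding.coeFn_mk]
    rw [f_of_pos (n := p + 1) (by push_cast; ring) (by omega)]
  · intro j hj
    rw [Function.mem_support] at hj
    have h1 : (m : ℤ) + j ≤ L := by
      by_contra! hc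
      exact hj (by rw [h j hc, zero_mul])
    have h2 : 0 < (m : ℤ) + j := by
      by_contra! hc
      exact hj (by rw [f_of_nonpos hc, mul_zero])
    simp only [Finset.coe_map, Function.Embedding.coeFn_mk, Set.mem_image, Finset.coe_range,
      Set.mem_Iio]
    exact ⟨(m + j - 1).toNat, by omega, by omega⟩

theorem sum_digit_lt (z : Fibonadic) (m L : ℕ) :
    ∑ p ∈ Finset.range L, z.digit (p + 1 - m) * Nat.fib (p + 2) < Nat.fib (L + 2) :=
  sum_fib_lt (fun p => z.digit (p + 1 - m)) (fun _ => z.digit_le_one _)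
    (fun p => by
      have := z.no_consecutive (p + 1 + 1 - m)
      rw [show (p : ℤ) + 1 + 1 - m - 1 = p + 1 - m by ring] at this
      push_cast
      exact this) L

theorem exists_bound (z w : Fibonadic) (m : ℕ) : ∃ L : ℕ, ∀ K : ℕ, L ≤ K →
    (∀ j : ℤ, (K : ℤ) < m + j → z.digit j = 0) ∧
      ∀ j : ℤ, (K : ℤ) < m + j → w.digit j = 0 := by
  obtain ⟨N, hN⟩ := z.eventually_zero
  obtain ⟨N', hN'⟩ := w.eventually_zero
  exact ⟨(m + max N N').toNat, fun K hK =>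
    ⟨fun j hj => hN j (by omega), fun j hj => hN' j (by omega)⟩⟩

/-- The common digits above `i` cancel, and by `sum_fib_lt` the digits of `z` below `i` cannot make
up for the term `f_{m+i}` of `w`. The condition `0 < m + i` ensures that this term is not truncated
away. -/
theorem rep_lt_rep_of_digit {z w : Fibonadic} {i : ℤ} (hz : z.digit i = 0) (hw : w.digit i = 1)
    (h : ∀ j, i < j → z.digit j = w.digit j) {m : ℕ} (hm : 0 < m + i) : z.rep m < w.rep m := by
  obtain ⟨L, hL⟩ := exists_bound z w m
  obtain ⟨q, hq⟩ : ∃ q : ℕ, (q : ℤ) + 1 - m = i := ⟨(m + i - 1).toNat, by omega⟩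
  obtain ⟨h1, h2⟩ := hL (q + 1 + L) (by omega)
  rw [rep_eq_sum z m _ h1, rep_eq_sum w m _ h2, Finset.sum_range_add _ (q + 1) L,
    Finset.sum_range_add _ (q + 1) L, Finset.sum_range_succ, Finset.sum_range_succ, hq, hz, hw]
  have h3 : ∑ x ∈ Finset.range L, z.digit (((q + 1 + x : ℕ) : ℤ) + 1 - m) *
        Nat.fib (q + 1 + x + 2) =
      ∑ x ∈ Finset.range L, w.digit (((q + 1 + x : ℕ) : ℤ) + 1 - m) *
        Nat.fib (q + 1 + x + 2) :=
    Finset.sum_congr rfl fun x _ => by rw [h _ (by push_cast; omega)]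
  have h4 := sum_digit_lt z m q
  omega

theorem rep_mono {z w : Fibonadic} (h : z ≤ w) (m : ℕ) : z.rep m ≤ w.rep m := by
  rcases h.eq_or_lt with rfl | h
  · exact le_rfl
  obtain ⟨i, hz, hw, hj⟩ := lt_def.1 h
  by_cases hm : 0 < m + i
  · exact (rep_lt_rep_of_digit hz hw hj hm).le
  · obtain ⟨L, hL⟩ := exists_bound z w m
    obtain ⟨h1, h2⟩ := hL L le_rfl
    rw [rep_eq_sum z m _ h1, rep_eq_sum w m _ h2]
    exact (Finset.sum_congr rfl fun x _ => by rw [hj _ (by omega)]).le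

theorem eventually_rep_lt {z w : Fibonadic} (h : z < w) :
    ∀ᶠ m in Filter.atTop, z.rep m < w.rep m := by
  obtain ⟨i, hz, hw, hj⟩ := lt_def.1 h
  filter_upwards [Filter.eventually_gt_atTop (-i).toNat] with m hm
  exact rep_lt_rep_of_digit hz hw hj (by omega)

theorem eventually_rep_le_iff {z w : Fibonadic} :
    (∀ᶠ m in Filter.atTop, w.rep m ≤ z.rep m) ↔ w ≤ z := by
  refine ⟨fun h => ?_, fun h => Filter.Eventually.of_forall (rep_mono h)⟩
  by_contra! hc
  obtain ⟨m, h1, h2⟩ := (h.and (eventually_rep_lt hc)).exists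
  omega

/-! ### Principal units and predecessors -/

theorem mem_principalUnits_iff {z : Fibonadic} :
    z ∈ principalUnits ↔ phiPow 0 ≤ z ∧ z < phiPow 1 := by
  constructor
  · rintro ⟨h0, h1⟩
    refine ⟨?_, lt_def.2 ⟨1, h1 1 one_pos, by simp [phiPow], fun j hj => ?_⟩⟩
    · by_contra! hc
      obtain ⟨i, hz, hw, -⟩ := lt_def.1 hc
      simp only [phiPow, ite_eq_left_iff, zero_ne_one, imp_false, not_not] at hw
      subst hw
      omega
    · rw [h1 j (by omega)]
      simp [phiPow, hj.ne']
  · rintro ⟨h0, h1⟩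
    have hpos : ∀ i, 0 < i → z.digit i = 0 := by
      obtain ⟨i, hz, hw, hj⟩ := lt_def.1 h1
      simp only [phiPow, ite_eq_left_iff, zero_ne_one, imp_false, not_not] at hw
      subst hw
      intro j hj0
      rcases (show (1 : ℤ) ≤ j by omega).eq_or_lt with rfl | h
      · exact hz
      · rw [hj j h]
        simp [phiPow, h.ne']
    refine ⟨?_, hpos⟩
    rcases h0.eq_or_lt with rfl | h0
    · simp [phiPow]
    · obtain ⟨i, hz, hw, hj⟩ := lt_def.1 h0
      have hi : i < 0 := by
        rcases lt_trichotomy i 0 with h | rfl | h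
        · exact h
        · simp [phiPow] at hz
        · rw [hpos i h] at hw
          omega
      rw [← hj 0 hi]
      simp [phiPow]

theorem phiPow_zero_mem : phiPow 0 ∈ principalUnits :=
  ⟨by simp [phiPow], fun i hi => by simp [phiPow, hi.ne']⟩

theorem isFin_phiPow (k : ℤ) : (phiPow k).IsFin := by
  refine ⟨|k|, fun i hi => ?_⟩
  have h1 := le_abs_self k
  have h2 := neg_abs_le k
  simp only [phiPow]
  exact ⟨if_neg (by omega), if_neg (by omega)⟩

theorem IsFin.exists_isLeast {z : Fibonadic} (hz : z.IsFin) (h1 : phiPow 0 ≤ z) :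
    ∃ n₀, IsLeast {i | z.digit i = 1} n₀ := by
  obtain ⟨N, hN⟩ := hz
  have hne : ∃ i, z.digit i = 1 := by
    rcases h1.eq_or_lt with rfl | h
    · exact ⟨0, by simp [phiPow]⟩
    · obtain ⟨i, -, hi, -⟩ := lt_def.1 h
      exact ⟨i, hi⟩
  obtain ⟨n, hn, hmin⟩ := Int.exists_least_of_bdd (P := fun i => z.digit i = 1)
    ⟨-N, fun i hi => by
      by_contra! hc
      have := (hN (-i) (by omega)).2
      rw [neg_neg] at this
      omega⟩ hne
  exact ⟨n, hn, hmin⟩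

theorem minus_digit {z : Fibonadic} (h : ∃ n₀, IsLeast {i | z.digit i = 1} n₀) :
    ∃ n, IsLeast {i | z.digit i = 1} n ∧
      ∀ i, z.minus.digit i = if n < i then z.digit i else if Even (i - n) then 0 else 1 := by
  refine ⟨h.choose, h.choose_spec, fun i => ?_⟩
  rw [minus, dif_pos h]

/-- The tail `0 1 0 1 …` is the largest one that starts with `0`, so `z⁻` is the immediate
predecessor of `z`. Closed intervals ending at `z⁻` are thereby half-open intervals ending at `z`.
-/
theorem le_minus_iff_of_isLeast {z : Fibonadic} (h : ∃ n₀, IsLeast {i | z.digit i = 1} n₀)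
    (y : Fibonadic) : y ≤ z.minus ↔ y < z := by
  obtain ⟨n, ⟨hn, hmin⟩, hd⟩ := minus_digit h
  simp only [Set.mem_ofPred_eq] at hn
  constructor
  · refine fun hy => hy.trans_lt (lt_def.2 ⟨n, ?_, hn, fun j hj => ?_⟩)
    · rw [hd, if_neg (lt_irrefl n), if_pos (by simp)]
    · rw [hd, if_pos hj]
  · intro hy
    obtain ⟨i, hyi, hzi, hj⟩ := lt_def.1 hy
    rcases (hmin hzi : n ≤ i).eq_or_lt with rfl | hi
    · by_contra! hc
      obtain ⟨j, hmj, hyj, hk⟩ := lt_def.1 hc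
      rcases lt_trichotomy j n with h' | rfl | h'
      · have hpar : Even (j - n) := by
          by_contra hodd
          rw [hd, if_neg (by omega), if_neg hodd] at hmj
          omega
        have h2 := hk (j + 1) (by omega)
        rw [hd, if_neg (by rcases hpar with ⟨r, hr⟩; omega),
          if_neg (by rcases hpar with ⟨r, hr⟩; rw [Int.not_even_iff]; omega)] at h2
        have h3 := y.no_consecutive (j + 1)
        rw [add_sub_cancel_right, ← h2, hyj] at h3
        omega
      · omega
      · rw [hd, if_pos h', ← hj j h'] at hmj
        omega
    · refine (lt_def.2 ⟨i, hyi, by rw [hd, if_pos hi, hzi], fun j hij => ?_⟩).le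
      rw [hd, if_pos (by omega), hj j hij]

theorem IsFin.le_minus_iff {z : Fibonadic} (hz : z.IsFin) (h1 : phiPow 0 ≤ z) (y : Fibonadic) :
    y ≤ z.minus ↔ y < z :=
  le_minus_iff_of_isLeast (hz.exists_isLeast h1) y

/-! ### Finite expansions -/

/-- The finite Fibonadic number with digit `1` exactly at the indices in `S`. -/
def ofFinset (S : Finset ℤ) (hS : ∀ i ∈ S, i + 1 ∉ S) : Fibonadic where
  digit i := if i ∈ S then 1 else 0
  digit_le_one i := by split_ifs <;> simp
  eventually_zero := by
    obtain ⟨N, hN⟩ := S.bddAbove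
    exact ⟨N, fun i hi => if_neg fun h => absurd (hN h) (by omega)⟩
  no_consecutive i := by
    split_ifs with h1 h2
    · exact absurd (by simpa using h1) (hS _ h2)
    all_goals simp

theorem isFin_ofFinset (S : Finset ℤ) (hS : ∀ i ∈ S, i + 1 ∉ S) : (ofFinset S hS).IsFin := by
  obtain ⟨N, hN⟩ := S.bddAbove
  obtain ⟨N', hN'⟩ := S.bddBelow
  refine ⟨max N (-N'), fun i hi => ⟨if_neg fun h => ?_, if_neg fun h => ?_⟩⟩
  · have := hN h
    omega
  · have := hN' h
    omega

theorem rep_ofFinset (S : Finset ℤ) (hS : ∀ i ∈ S, i + 1 ∉ S) (m : ℕ) :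
    (ofFinset S hS).rep m = ∑ j ∈ S, f (m + j) := by
  rw [rep, finsum_eq_sum_of_support_subset (s := S)]
  · refine Finset.sum_congr rfl fun j hj => ?_
    simp [ofFinset, hj]
  · intro j hj
    by_contra hc
    exact hj (by simp [ofFinset, show j ∉ S from hc])

end Fibonadic

/-! ### Normalizing Fibonacci sums by carrying -/

section Carry

variable {G : Type*} [AddCommMonoid G]

/-- One term can be added to a sum over nonconsecutive indices, provided that sums with fewer
terms can be normalized. -/
theorem exists_nonconsecutive_insert {u : ℤ → G} (hu : ∀ k, u (k + 2) = u (k + 1) + u k) {s : ℕ}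
    (ih : ∀ t : Multiset ℤ, t.card ≤ s → ∃ S : Finset ℤ, (∀ i ∈ S, i + 1 ∉ S) ∧ S.card ≤ s ∧
      ∑ j ∈ S, u j = (t.map u).sum) (r : ℕ) :
    ∀ (S : Finset ℤ) (k : ℤ), (∀ i ∈ S, i + 1 ∉ S) → S.card ≤ s →
      (S.filter (· ≤ k)).card ≤ r →
      ∃ T : Finset ℤ, (∀ i ∈ T, i + 1 ∉ T) ∧ T.card ≤ s + 1 ∧
        ∑ j ∈ T, u j = u k + ∑ j ∈ S, u j := by
  -- Here `r` bounds the number of indices of `S` at or below `k`; it decreases when a doubled term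
  -- pushes a carry down to `k - 2`.
  induction r using Nat.strong_induction_on with
  | _ r ihr =>
  intro S k hS hs hr
  have hexp (i : ℤ) : u i + u (i + 1) = u (i + 2) := by rw [hu, add_comm]
  by_cases hk : k ∈ S
  · have hk1 : k + 1 ∉ S := hS k hk
    -- Split one copy of `u k` as `u (k - 1) + u (k - 2)` and merge `u (k - 1)` with the other copy.
    have htwo : u k + u k = u (k + 1) + u (k - 2) := by
      have h1 := hexp (k - 2)
      have h2 := hexp (k - 1)
      rw [show k - 2 + 1 = k - 1 by ring, sub_add_cancel] at h1
      rw [sub_add_cancel, show k - 1 + 2 = k + 1 by ring] at h2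
      rw [← h2]
      nth_rw 1 [← h1]
      abel
    have hcard := Finset.card_erase_add_one hk
    have hsum : u k + ∑ j ∈ S, u j = u (k - 2) + (u (k + 1) + ∑ j ∈ S.erase k, u j) := by
      rw [← Finset.add_sum_erase S u hk, ← add_assoc, htwo]
      abel
    -- If `k + 2` is occupied, `u (k + 1)` merges with it into `u (k + 3)`, leaving at most `s`
    -- terms for `ih`. Otherwise `k + 1` replaces `k` in `S`, and `k - 2` remains to be inserted.
    by_cases hk2 : k + 2 ∈ S
    · have hk2' : k + 2 ∈ S.erase k := Finset.mem_erase.2 ⟨by omega, hk2⟩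
      have hcard2 := Finset.card_erase_add_one hk2'
      obtain ⟨T, hT, hc, h⟩ := ih ((k - 2) ::ₘ (k + 3) ::ₘ ((S.erase k).erase (k + 2)).val) (by
        rw [Multiset.card_cons, Multiset.card_cons, Finset.card_val]
        omega)
      refine ⟨T, hT, by omega, ?_⟩
      have h3 := hexp (k + 1)
      rw [show k + 1 + 1 = k + 2 by ring, show k + 1 + 2 = k + 3 by ring] at h3
      rw [h, hsum, ← Finset.add_sum_erase _ u hk2', ← add_assoc (u (k + 1)), h3]
      simp [Finset.sum_eq_multiset_sum]
    · have hk1' : k + 1 ∉ S.erase k := fun h => hk1 (Finset.mem_of_mem_erase h)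
      have hlt : ((insert (k + 1) (S.erase k)).filter (· ≤ k - 2)).card <
          (S.filter (· ≤ k)).card := by
        refine Finset.card_lt_card ⟨fun i hi => ?_, fun hsub => ?_⟩
        · simp only [Finset.mem_filter, Finset.mem_insert, Finset.mem_erase] at hi ⊢
          exact ⟨by rcases hi with ⟨h | h, h'⟩ <;> [omega; exact h.2], by omega⟩
        · have := hsub (Finset.mem_filter.2 ⟨hk, le_rfl⟩)
          rw [Finset.mem_filter] at this
          omega
      obtain ⟨T, hT, hc, h⟩ := ihr _ (hlt.trans_le hr) (insert (k + 1) (S.erase k)) (k - 2)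
        (fun i hi hi' => by
          rw [Finset.mem_insert, Finset.mem_erase] at hi hi'
          rcases hi with rfl | ⟨h1, h2⟩
          · rcases hi' with h' | ⟨-, h'⟩
            · omega
            · exact hk2 (by rwa [show k + 1 + 1 = k + 2 by ring] at h')
          · rcases hi' with h' | ⟨-, h'⟩
            · omega
            · exact hS i h2 h')
        (by rw [Finset.card_insert_of_notMem hk1']; omega) le_rfl
      exact ⟨T, hT, hc, by rw [h, Finset.sum_insert hk1', hsum]⟩
  -- Merging with a neighbour leaves at most `s` terms, so `ih` applies; with no neighbour present,
  -- `k` is simply inserted.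
  · have hmerge (i : ℤ) (hi : i ∈ S) (l : ℤ) (h : u k + u i = u l) :
        ∃ T : Finset ℤ, (∀ i ∈ T, i + 1 ∉ T) ∧ T.card ≤ s + 1 ∧
          ∑ j ∈ T, u j = u k + ∑ j ∈ S, u j := by
      have hcard := Finset.card_erase_add_one hi
      obtain ⟨T, hT, hc, h'⟩ := ih (l ::ₘ (S.erase i).val) (by
        rw [Multiset.card_cons, Finset.card_val]
        omega)
      refine ⟨T, hT, by omega, ?_⟩
      rw [h', ← Finset.add_sum_erase S u hi, ← add_assoc, h]
      simp [Finset.sum_eq_multiset_sum]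
    by_cases hk1 : k + 1 ∈ S
    · exact hmerge _ hk1 _ (hexp k)
    by_cases hk2 : k - 1 ∈ S
    · refine hmerge _ hk2 (k + 1) ?_
      have h2 := hexp (k - 1)
      rw [sub_add_cancel, show k - 1 + 2 = k + 1 by ring] at h2
      rw [add_comm, h2]
    · refine ⟨insert k S, fun i hi hi' => ?_, ?_, Finset.sum_insert hk⟩
      · rw [Finset.mem_insert] at hi hi'
        rcases hi with rfl | hi
        · rcases hi' with h' | h'
          · omega
          · exact hk1 h'
        · rcases hi' with h' | h'
          · exact hk2 (by rwa [← h', add_sub_cancel_right])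
          · exact hS i hi h'
      · rw [Finset.card_insert_of_notMem hk]
        omega

/-- Any sum of terms of a sequence satisfying the Fibonacci recursion equals a sum of terms
with distinct nonconsecutive indices. -/
theorem exists_nonconsecutive_sum {u : ℤ → G} (hu : ∀ k, u (k + 2) = u (k + 1) + u k)
    (t : Multiset ℤ) :
    ∃ S : Finset ℤ, (∀ i ∈ S, i + 1 ∉ S) ∧ ∑ j ∈ S, u j = (t.map u).sum := by
  suffices h : ∀ s : ℕ, ∀ t : Multiset ℤ, t.card ≤ s →
      ∃ S : Finset ℤ, (∀ i ∈ S, i + 1 ∉ S) ∧ S.card ≤ s ∧ ∑ j ∈ S, u j = (t.map u).sum by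
    obtain ⟨S, hS, -, h⟩ := h _ t le_rfl
    exact ⟨S, hS, h⟩
  intro s
  induction s with
  | zero =>
    intro t ht
    have : t = 0 := by simpa using ht
    subst this
    exact ⟨∅, by simp, by simp, by simp⟩
  | succ s ih =>
    intro t ht
    induction t using Multiset.induction_on with
    | empty => exact ⟨∅, by simp, by simp, by simp⟩
    | cons k t _ =>
      rw [Multiset.card_cons] at ht
      obtain ⟨S, hS, hs, hsum⟩ := ih t (by omega)
      obtain ⟨T, hT, hc, h⟩ := exists_nonconsecutive_insert hu ih _ S k hS hs le_rfl
      exact ⟨T, hT, hc, by rw [h, hsum, Multiset.map_cons, Multiset.sum_cons]⟩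

end Carry

/-! ### Thresholds of vertices -/

open Filter in
/-- Eventually in `m`, the number `a f_{m+i} + b f_{m+j}` is represented by a fixed finite
Fibonadic number. -/
theorem exists_isFin_rep_eq (a b : ℕ) (i j : ℤ) : ∃ w : Fibonadic, w.IsFin ∧
    ∀ᶠ m : ℕ in atTop, w.rep m = a * f (m + i) + b * f (m + j) := by
  -- The recursion for `f` fails near index `0`, but for germs in `m` the shifts `m ↦ f (m + k)`
  -- satisfy it at every integer `k`.
  let u : ℤ → Germ (atTop : Filter ℕ) ℕ := fun k => ((fun m : ℕ => f (m + k) : ℕ → ℕ) : Germ _ _)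
  have hu (k : ℤ) : u (k + 2) = u (k + 1) + u k := by
    rw [← Germ.coe_add]
    refine Germ.coe_eq.2 ?_
    filter_upwards [eventually_gt_atTop (-k).toNat] with m hm
    obtain ⟨n, hn⟩ : ∃ n : ℕ, (m : ℤ) + k = n := ⟨(m + k).toNat, by omega⟩
    rw [Pi.add_apply, f_of_pos (n := n + 2) (by push_cast; omega) (by omega),
      f_of_pos (n := n + 1) (by push_cast; omega) (by omega), f_of_pos (n := n) hn (by omega),
      show n + 2 + 1 = n + 1 + 2 from rfl, Nat.fib_add_two, add_comm]
  obtain ⟨S, hS, h⟩ := exists_nonconsecutive_sum hu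
    (Multiset.replicate a i + Multiset.replicate b j)
  refine ⟨Fibonadic.ofFinset S hS, Fibonadic.isFin_ofFinset S hS, ?_⟩
  have h1 : ∑ l ∈ S, u l = ((fun m : ℕ => ∑ l ∈ S, f (m + l) : ℕ → ℕ) : Germ atTop ℕ) := by
    have := map_sum (Germ.coeAddHom (atTop : Filter ℕ) (M := ℕ))
      (fun (l : ℤ) (m : ℕ) => f (m + l)) S
    simp only [Germ.coe_coeAddHom] at this
    rw [← this]
    congr 1
    ext m
    simp
  have h2 : ((Multiset.replicate a i + Multiset.replicate b j).map u).sum =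
      ((fun m : ℕ => a * f (m + i) + b * f (m + j) : ℕ → ℕ) : Germ atTop ℕ) := by
    rw [Multiset.map_add, Multiset.sum_add, Multiset.map_replicate, Multiset.map_replicate,
      Multiset.sum_replicate, Multiset.sum_replicate]
    rfl
  rw [h1, h2] at h
  filter_upwards [Germ.coe_eq.1 h] with m hm
  rw [Fibonadic.rep_ofFinset, hm]

theorem le_fib_succ (m : ℕ) : m ≤ Nat.fib (m + 1) := by
  have := Nat.le_fib_add_one (m + 1)
  omega

theorem f_le_rep_lt {z : Fibonadic} (hz : z ∈ principalUnits) {m : ℕ} (hm : 0 < m) :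
    Nat.fib (m + 1) ≤ z.rep m ∧ z.rep m < Nat.fib (m + 2) := by
  rw [Fibonadic.rep_eq_sum z m m fun j hj => hz.2 j (by omega)]
  refine ⟨?_, Fibonadic.sum_digit_lt z m m⟩
  obtain ⟨n, rfl⟩ : ∃ n, m = n + 1 := ⟨m - 1, by omega⟩
  rw [Finset.sum_range_succ, show ((n : ℤ) + 1 - ((n + 1 : ℕ) : ℤ)) = 0 by push_cast; ring, hz.1,
    one_mul]
  exact Nat.le_add_left _ _

theorem maxIndex_rep {z : Fibonadic} (hz : z ∈ principalUnits) {m : ℕ} (hm : 0 < m) :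
    maxIndex (z.rep m) = m := by
  obtain ⟨h1, h2⟩ := f_le_rep_lt hz hm
  -- The search in `maxIndex` stops at `R`; the estimate `m ≤ f_m ≤ R` keeps `m` in range.
  refine Nat.findGreatest_eq_iff.2 ⟨(le_fib_succ m).trans h1, fun _ => ?_, fun {k} hk _ => ?_⟩
  · rwa [f_of_pos rfl hm]
  · rw [f_of_pos rfl (hm.trans hk), not_le]
    exact h2.trans_le (Nat.fib_mono (by omega))

theorem mem_base_iff (n : ℕ) {z : Fibonadic} (hz : z ∈ principalUnits) (v : Vertex) :
    v ∈ base n z ↔ ∀ᶠ m in Filter.atTop, vnorm (m - n - 1) v ≤ z.rep m := by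
  refine Filter.eventually_congr ?_
  filter_upwards [Filter.eventually_gt_atTop 0] with m hm
  rw [baseNat, maxIndex_rep hz hm]
  rfl

/-- The norm `|v|_{m-n-1}` is a combination of `f_{m-n}` and `f_{m-n-1}` with coefficients
independent of `m`, so it is eventually the coherent sequence of one finite number. The threshold
itself need not be a principal unit. -/
theorem exists_threshold (n : ℕ) (v : Vertex) : ∃ w : Fibonadic, w.IsFin ∧
    ∀ z ∈ principalUnits, v ∈ base n z ↔ w ≤ z := by
  obtain ⟨w, hw, h⟩ := exists_isFin_rep_eq (len (mother v)) (len (father v)) (-n) (-n - 1)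
  refine ⟨w, hw, fun z hz => ?_⟩
  rw [mem_base_iff n hz, ← Fibonadic.eventually_rep_le_iff]
  refine Filter.eventually_congr ?_
  filter_upwards [h, Filter.eventually_gt_atTop (n + 1)] with m hm hmn
  obtain ⟨k, rfl⟩ : ∃ k, m = k + 1 + n + 1 := ⟨m - n - 2, by omega⟩
  rw [hm, vnorm, show k + 1 + n + 1 - n - 1 = k + 1 by omega,
    f_of_pos (n := k + 2) (by push_cast; ring) (by omega),
    f_of_pos (n := k + 1) (by push_cast; ring) (by omega), mul_comm, mul_comm (Nat.fib _)]

theorem fib_add_le (k n : ℕ) : Nat.fib (k + 2 + n) ≤ 2 ^ n * Nat.fib (k + 2) := by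
  induction n with
  | zero => simp
  | succ n ih =>
    have h1 : Nat.fib (k + 2 + (n + 1)) = Nat.fib (k + 1 + n) + Nat.fib (k + 2 + n) := by
      rw [show k + 2 + (n + 1) = k + 1 + n + 2 by ring, Nat.fib_add_two,
        show k + 1 + n + 1 = k + 2 + n by ring]
    have h2 : Nat.fib (k + 1 + n) ≤ Nat.fib (k + 2 + n) := Nat.fib_mono (by omega)
    rw [h1, pow_succ]
    linarith

/-- The union of all bases of a given height is finite. -/
theorem exists_finite_base_subset (n : ℕ) :
    ∃ A : Set Vertex, A.Finite ∧ ∀ z ∈ principalUnits, base n z ⊆ A := by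
  -- With `k = m - n - 1`, `a_{k+2} |M(v)| ≤ R^z_m < a_{m+2} ≤ 2^{n+1} a_{k+2}`, and `|v|` is at
  -- most twice `|M(v)|`.
  refine ⟨_, finite_len_le (2 * 2 ^ (n + 1)), fun z hz v hv => ?_⟩
  rw [mem_base_iff n hz] at hv
  obtain ⟨m, hm, hmn⟩ := (hv.and (Filter.eventually_gt_atTop (n + 1))).exists
  obtain ⟨k, rfl⟩ : ∃ k, m = k + n + 1 := ⟨m - n - 1, by omega⟩
  rw [show k + n + 1 - n - 1 = k by omega] at hm
  have h1 := (f_le_rep_lt hz (m := k + n + 1) (by omega)).2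
  have h2 := fib_add_le k (n + 1)
  rw [show k + 2 + (n + 1) = k + n + 1 + 2 by ring] at h2
  have h3 : Nat.fib (k + 2) * len (mother v) < Nat.fib (k + 2) * 2 ^ (n + 1) := by
    have : Nat.fib (k + 2) * len (mother v) ≤ vnorm k v := Nat.le_add_right _ _
    rw [mul_comm _ (2 ^ (n + 1))]
    omega
  have h4 := Nat.lt_of_mul_lt_mul_left h3
  have h5 := len_le_two_mul_len_mother v
  simp only [Set.mem_ofPred_eq]
  omega

theorem finite_configs (n : ℕ) : (configs n).Finite := by
  obtain ⟨A, hA, h⟩ := exists_finite_base_subset n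
  exact hA.finite_subsets.subset (by rintro _ ⟨z, hz, rfl⟩; exact h z hz)

theorem base_mono (n : ℕ) {y z : Fibonadic} (hy : y ∈ principalUnits) (hz : z ∈ principalUnits)
    (h : y ≤ z) : base n y ⊆ base n z := fun v hv => by
  obtain ⟨w, -, hw⟩ := exists_threshold n v
  exact (hw z hz).2 (((hw y hy).1 hv).trans h)

/-- Restriction: the branching points of a base form the base of the next lower height. -/
theorem branching_base (n : ℕ) {z : Fibonadic} (hz : z ∈ principalUnits) :
    branching (base (n + 1) z) = base n z := by
  ext v
  change v ∈ base (n + 1) z ∧ upperChild v ∈ base (n + 1) z ∧ lowerChild v ∈ base (n + 1) z ↔ _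
  simp only [mem_base_iff _ hz, ← Filter.eventually_and]
  refine Filter.eventually_congr ?_
  filter_upwards [Filter.eventually_gt_atTop (n + 1)] with m hm
  obtain ⟨k, rfl⟩ : ∃ k, m = k + n + 2 := ⟨m - n - 2, by omega⟩
  rw [show k + n + 2 - (n + 1) - 1 = k by omega, show k + n + 2 - n - 1 = k + 1 by omega]
  -- Norms grow with `k`, so the membership of `v` follows from that of its two children.
  have h1 := vnorm_le_vnorm_succ k v
  rw [vnorm_succ_eq_max] at h1 ⊢
  omega

/-! ### Breakpoints -/

/-- The least principal units of the fibres of `base n`. -/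
def fibreMinima (n : ℕ) : Set Fibonadic :=
  {z | z ∈ principalUnits ∧ ∀ y ∈ principalUnits, y < z → base n y ≠ base n z}

/-- Nothing changes between `z` and the largest threshold at or below it, while crossing that
threshold downwards loses its vertex. So this threshold is the minimum of the fibre of `z`;
adjoining `1` covers the case that no threshold lies in `[1, z]`. -/
theorem exists_finite_thresholds (n : ℕ) : ∃ T : Set Fibonadic, T.Finite ∧ (∀ t ∈ T, t.IsFin) ∧
    ∀ z ∈ principalUnits, ∃ t ∈ fibreMinima n, t ∈ T ∧ t ≤ z ∧ base n t = base n z := by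
  choose w hw hwz using exists_threshold n
  obtain ⟨A, hA, hbase⟩ := exists_finite_base_subset n
  have hT : (insert (Fibonadic.phiPow 0) (w '' A)).Finite := (hA.image w).insert _
  refine ⟨_, hT, ?_, fun z hz => ?_⟩
  · rintro t (rfl | ⟨v, -, rfl⟩)
    · exact Fibonadic.isFin_phiPow 0
    · exact hw v
  · obtain ⟨h0, h1⟩ := Fibonadic.mem_principalUnits_iff.1 hz
    obtain ⟨t, ⟨⟨htT, ht0, htz⟩, hmax⟩⟩ :=
      (hT.inter_of_left (Set.Icc (Fibonadic.phiPow 0) z)).exists_maximal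
        ⟨Fibonadic.phiPow 0, Or.inl rfl, le_rfl, h0⟩
    have ht : t ∈ principalUnits :=
      Fibonadic.mem_principalUnits_iff.2 ⟨ht0, htz.trans_lt h1⟩
    refine ⟨t, ⟨ht, fun y hy hyt heq => ?_⟩, htT, htz, ?_⟩
    · rcases htT with rfl | ⟨v, -, rfl⟩
      · exact absurd (Fibonadic.mem_principalUnits_iff.1 hy).1 (not_le.2 hyt)
      · have : v ∈ base n y := by
          rw [heq]
          exact (hwz v _ ht).2 le_rfl
        exact absurd ((hwz v y hy).1 this) (not_le.2 hyt)
    · refine (base_mono n ht hz htz).antisymm fun v hv => (hwz v t ht).2 ?_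
      have hvz := (hwz v z hz).1 hv
      rcases le_total (w v) (Fibonadic.phiPow 0) with h | h
      · exact h.trans ht0
      · by_contra! hc
        exact absurd (hmax ⟨Or.inr ⟨v, hbase z hz hv, rfl⟩, h, hvz⟩ hc.le) (not_le.2 hc)

theorem base_injOn_fibreMinima (n : ℕ) : Set.InjOn (base n) (fibreMinima n) := by
  intro y hy z hz h
  rcases lt_trichotomy y z with hlt | rfl | hlt
  · exact absurd h (hz.2 y hy.1 hlt)
  · rfl
  · exact absurd h.symm (hy.2 z hz.1 hlt)

theorem image_fibreMinima (n : ℕ) : base n '' fibreMinima n = configs n := by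
  obtain ⟨T, -, -, h⟩ := exists_finite_thresholds n
  refine (Set.image_mono fun z hz => hz.1).antisymm ?_
  rintro _ ⟨z, hz, rfl⟩
  obtain ⟨t, ht, -, -, he⟩ := h z hz
  exact ⟨t, ht, he⟩

theorem ncard_fibreMinima (n : ℕ) : (fibreMinima n).ncard = (configs n).ncard := by
  rw [← image_fibreMinima, (base_injOn_fibreMinima n).ncard_image]

theorem isFin_of_mem_fibreMinima {n : ℕ} {z : Fibonadic} (hz : z ∈ fibreMinima n) : z.IsFin := by
  obtain ⟨T, -, hT, h⟩ := exists_finite_thresholds n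
  obtain ⟨t, ht, htT, -, he⟩ := h z hz.1
  exact base_injOn_fibreMinima n ht hz he ▸ hT t htT

theorem finite_fibreMinima (n : ℕ) : (fibreMinima n).Finite :=
  Set.Finite.of_finite_image (by rw [image_fibreMinima]; exact finite_configs n)
    (base_injOn_fibreMinima n)

theorem phiPow_zero_mem_fibreMinima (n : ℕ) : Fibonadic.phiPow 0 ∈ fibreMinima n :=
  ⟨Fibonadic.phiPow_zero_mem, fun _ hy hlt =>
    absurd (Fibonadic.mem_principalUnits_iff.1 hy).1 (not_le.2 hlt)⟩

theorem phiPow_one_notMem (n : ℕ) : Fibonadic.phiPow 1 ∉ fibreMinima n := fun h =>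
  lt_irrefl _ (Fibonadic.mem_principalUnits_iff.1 h.1).2

/-- By restriction, equal bases of height `n + 1` have equal bases of height `n`, so the fibres at
`n + 1` refine those at `n`. -/
theorem fibreMinima_subset_succ (n : ℕ) : fibreMinima n ⊆ fibreMinima (n + 1) :=
  fun z hz => ⟨hz.1, fun y hy hlt h => hz.2 y hy hlt <| by
    rw [← branching_base n hy, ← branching_base n hz.1, h]⟩

/-! ### Characterization, existence and uniqueness of breakpoints -/

section IsBreakpoints

variable {n : ℕ} {c : Fin ((configs n).ncard + 1) → Fibonadic}

theorem breakpoints_lt_last (hc : StrictMono c) (hl : c (Fin.last _) = Fibonadic.phiPow 1)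
    (k : Fin (configs n).ncard) : c k.castSucc < Fibonadic.phiPow 1 := by
  rw [← hl]
  exact hc (Fin.castSucc_lt_last k)

/-- Every principal unit lies between two successive breakpoints. -/
theorem exists_between (h0 : c 0 = Fibonadic.phiPow 0) (hl : c (Fin.last _) = Fibonadic.phiPow 1)
    {z : Fibonadic} (hz : z ∈ principalUnits) :
    ∃ k : Fin (configs n).ncard, c k.castSucc ≤ z ∧ z < c k.succ := by
  obtain ⟨hz0, hz1⟩ := Fibonadic.mem_principalUnits_iff.1 hz
  by_contra! hno
  have : ∀ k, c k ≤ z := fun k => by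
    induction k using Fin.induction with
    | zero => rwa [h0]
    | succ k ih => exact hno k ih
  exact absurd (hl ▸ this (Fin.last _)) (not_le.2 hz1)

namespace IsBreakpoints

theorem phiPow_zero_le (hc : IsBreakpoints n c) (k) : Fibonadic.phiPow 0 ≤ c k := by
  rw [← hc.first]
  exact hc.strictMono.monotone (Fin.zero_le k)

theorem le_minus_iff (hc : IsBreakpoints n c) (k) (y : Fibonadic) : y ≤ (c k).minus ↔ y < c k :=
  (hc.isFin k).le_minus_iff (hc.phiPow_zero_le k) y

theorem mem_principalUnits (hc : IsBreakpoints n c) (k : Fin (configs n).ncard) :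
    c k.castSucc ∈ principalUnits :=
  Fibonadic.mem_principalUnits_iff.2
    ⟨hc.phiPow_zero_le _, breakpoints_lt_last hc.strictMono hc.last k⟩

theorem mem_principalUnits_of_mem_Icc (hc : IsBreakpoints n c) {k : Fin (configs n).ncard}
    {y : Fibonadic} (hy : y ∈ Set.Icc (c k.castSucc) (c k.succ).minus) : y ∈ principalUnits :=
  Fibonadic.mem_principalUnits_iff.2 ⟨(hc.phiPow_zero_le _).trans hy.1,
    ((hc.le_minus_iff _ _).1 hy.2).trans_le
      (hc.last ▸ hc.strictMono.monotone (Fin.le_last _))⟩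

theorem exists_mem_Icc (hc : IsBreakpoints n c) {z : Fibonadic} (hz : z ∈ principalUnits) :
    ∃ k : Fin (configs n).ncard, c k.castSucc ≤ z ∧ z ≤ (c k.succ).minus := by
  obtain ⟨k, h1, h2⟩ := exists_between hc.first hc.last hz
  exact ⟨k, h1, (hc.le_minus_iff _ _).2 h2⟩

theorem base_eq (hc : IsBreakpoints n c) {k : Fin (configs n).ncard} {z : Fibonadic}
    (hz : z ∈ principalUnits) (h : c k.castSucc ≤ z ∧ z ≤ (c k.succ).minus) :
    base n z = base n (c k.castSucc) :=
  ((hc.mem_iff k z hz).1 h).1.symm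

/-- The intervals cover `𝒟`, so their left ends realize every configuration; a surjection between
finite sets of equal size is injective. Hence different intervals carry different bases. -/
theorem base_injective (hc : IsBreakpoints n c) :
    Function.Injective fun k : Fin (configs n).ncard => base n (c k.castSucc) := by
  let g : Fin (configs n).ncard → configs n := fun k => ⟨_, _, hc.mem_principalUnits k, rfl⟩
  have hg : Function.Surjective g := by
    rintro ⟨_, z, hz, rfl⟩
    obtain ⟨k, hk⟩ := hc.exists_mem_Icc hz
    exact ⟨k, Subtype.ext (hc.base_eq hz hk).symm⟩
  have := (finite_configs n).to_subtype
  have hcard : Nat.card (Fin (configs n).ncard) = Nat.card (configs n) := by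
    rw [Nat.card_fin, Nat.card_coe_set_eq]
  have hbij := (Nat.bijective_iff_surjective_and_card g).2 ⟨hg, hcard⟩
  exact fun i j hij => hbij.1 (Subtype.ext hij)

theorem mem_Icc_iff (hc : IsBreakpoints n c) (k : Fin (configs n).ncard) {z : Fibonadic}
    (hz : z ∈ principalUnits) :
    (c k.castSucc ≤ z ∧ z ≤ (c k.succ).minus) ↔ base n z = base n (c k.castSucc) := by
  refine ⟨hc.base_eq hz, fun h => ?_⟩
  obtain ⟨j, hj⟩ := hc.exists_mem_Icc hz
  obtain rfl : j = k := hc.base_injective ((hc.base_eq hz hj).symm.trans h)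
  exact hj

/-- The right side does not involve `c`. A strictly increasing enumeration is determined by its
range, which gives uniqueness. -/
theorem range_eq (hc : IsBreakpoints n c) :
    Set.range c = insert (Fibonadic.phiPow 1) (fibreMinima n) := by
  ext z
  constructor
  · rintro ⟨k, rfl⟩
    induction k using Fin.lastCases with
    | last => exact Or.inl hc.last
    | cast k =>
      refine Or.inr ⟨hc.mem_principalUnits k, fun y hy hlt h => ?_⟩
      exact absurd ((hc.mem_Icc_iff k hy).2 h).1 (not_le.2 hlt)
  · rintro (rfl | hz)
    · exact ⟨_, hc.last⟩
    · obtain ⟨k, hk⟩ := hc.exists_mem_Icc hz.1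
      refine ⟨k.castSucc, hk.1.eq_of_not_lt fun hlt => ?_⟩
      exact hz.2 _ (hc.mem_principalUnits k) hlt (hc.base_eq hz.1 hk).symm

end IsBreakpoints

theorem isBreakpoints_of_range_eq (hs : StrictMono c)
    (hr : Set.range c = insert (Fibonadic.phiPow 1) (fibreMinima n)) : IsBreakpoints n c := by
  have hmem (k) : c k ∈ insert (Fibonadic.phiPow 1) (fibreMinima n) := hr ▸ Set.mem_range_self k
  have hbd (k) : Fibonadic.phiPow 0 ≤ c k ∧ c k ≤ Fibonadic.phiPow 1 := by
    have h01 := Fibonadic.mem_principalUnits_iff.1 Fibonadic.phiPow_zero_mem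
    rcases hmem k with h | h
    · rw [h]
      exact ⟨h01.2.le, le_rfl⟩
    · have := Fibonadic.mem_principalUnits_iff.1 h.1
      exact ⟨this.1, this.2.le⟩
  have h0 : c 0 = Fibonadic.phiPow 0 := by
    obtain ⟨k, hk⟩ : Fibonadic.phiPow 0 ∈ Set.range c := hr ▸ Or.inr (phiPow_zero_mem_fibreMinima n)
    exact ((hs.monotone (Fin.zero_le k)).trans_eq hk).antisymm (hbd 0).1
  have hl : c (Fin.last _) = Fibonadic.phiPow 1 := by
    obtain ⟨k, hk⟩ : Fibonadic.phiPow 1 ∈ Set.range c := hr ▸ Or.inl rfl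
    exact (hbd _).2.antisymm (hk.symm.trans_le (hs.monotone (Fin.le_last k)))
  have hfin (k) : (c k).IsFin := by
    rcases hmem k with h | h
    · rw [h]
      exact Fibonadic.isFin_phiPow 1
    · exact isFin_of_mem_fibreMinima h
  have hle (k) (y) : y ≤ (c k).minus ↔ y < c k := (hfin k).le_minus_iff (hbd k).1 y
  have hmin {k} (hk : c k < Fibonadic.phiPow 1) : c k ∈ fibreMinima n :=
    (hmem k).resolve_left hk.ne
  have hcast (k : Fin (configs n).ncard) : c k.castSucc ∈ fibreMinima n :=
    hmin (breakpoints_lt_last hs hl k)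
  -- The fibre minimum `t` below `z` is some `c j` with `j ≤ k`; monotonicity squeezes the base at
  -- `c k` between those at `t` and at `z`, which agree.
  have hconst (k : Fin (configs n).ncard) (z) (hz : z ∈ principalUnits) (h1 : c k.castSucc ≤ z)
      (h2 : z < c k.succ) : base n (c k.castSucc) = base n z := by
    obtain ⟨T, -, -, hT⟩ := exists_finite_thresholds n
    obtain ⟨t, ht, -, htz, he⟩ := hT z hz
    obtain ⟨j, rfl⟩ : t ∈ Set.range c := hr ▸ Or.inr ht
    have hj : j ≤ k.castSucc := by
      have := hs.lt_iff_lt.1 (htz.trans_lt h2)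
      rw [Fin.lt_def, Fin.val_succ] at this
      rw [Fin.le_def, Fin.val_castSucc]
      omega
    refine (base_mono n (hcast k).1 hz h1).antisymm ?_
    rw [← he]
    exact base_mono n ht.1 (hcast k).1 (hs.monotone hj)
  refine ⟨hfin, hs, h0, hl, fun k z hz => ?_⟩
  have hk : c k.castSucc < c k.succ := hs Fin.castSucc_lt_succ
  have hm : (c k.succ).minus ∈ principalUnits := Fibonadic.mem_principalUnits_iff.2
    ⟨(hbd _).1.trans ((hle _ _).2 hk), ((hle _ _).1 le_rfl).trans_le (hbd _).2⟩
  constructor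
  · rintro ⟨h1, h2⟩
    have e1 := hconst k z hz h1 ((hle _ _).1 h2)
    exact ⟨e1, e1 ▸ hconst k _ hm ((hle _ _).2 hk) ((hle _ _).1 le_rfl)⟩
  · rintro ⟨h1, -⟩
    refine ⟨not_lt.1 fun hlt => (hcast k).2 z hz hlt h1.symm, (hle _ _).2 ?_⟩
    -- If `z` reached `c (k+1)`, then `c (k+1) < Φ` would be a fibre minimum, yet by monotonicity it
    -- would have the same base as the smaller `c k`.
    by_contra! hge
    have hsucc := hmin (hge.trans_lt (Fibonadic.mem_principalUnits_iff.1 hz).2)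
    refine hsucc.2 _ (hcast k).1 hk ?_
    refine (base_mono n (hcast k).1 hsucc.1 hk.le).antisymm ?_
    rw [h1]
    exact base_mono n hsucc.1 hz hge

theorem existsUnique_isBreakpoints (n : ℕ) :
    ∃! c : Fin ((configs n).ncard + 1) → Fibonadic, IsBreakpoints n c := by
  have hfin : (insert (Fibonadic.phiPow 1) (fibreMinima n)).Finite := (finite_fibreMinima n).insert _
  have hcard : hfin.toFinset.card = (configs n).ncard + 1 := by
    rw [← Set.ncard_eq_toFinset_card _ hfin,
      Set.ncard_insert_of_notMem (phiPow_one_notMem n) (finite_fibreMinima n), ncard_fibreMinima]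
  refine ⟨hfin.toFinset.orderEmbOfFin hcard, isBreakpoints_of_range_eq
    (OrderEmbedding.strictMono _) ?_, fun c' hc' => ?_⟩
  · rw [Finset.range_orderEmbOfFin, hfin.coe_toFinset]
  · refine Finset.orderEmbOfFin_unique hcard (fun k => ?_) hc'.strictMono
    rw [hfin.mem_toFinset, ← hc'.range_eq]
    exact Set.mem_range_self k

end IsBreakpoints

end FareyFib

theorem mainTheorem6 :
    (∀ n : ℕ, (FareyFib.configs n).Finite ∧
      ∃! c : Fin ((FareyFib.configs n).ncard + 1) → FareyFib.Fibonadic,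
        FareyFib.IsBreakpoints n c) ∧
    (∀ (n : ℕ) (c : Fin ((FareyFib.configs n).ncard + 1) → FareyFib.Fibonadic),
      FareyFib.IsBreakpoints n c →
      ∀ k : Fin (FareyFib.configs n).ncard, ∀ z ∈ FareyFib.principalUnits,
        (c k.castSucc ≤ z ∧ z ≤ (c k.succ).minus) ↔
          FareyFib.base n z = FareyFib.base n (c k.castSucc)) ∧
    (∀ n : ℕ, ∀ z ∈ FareyFib.principalUnits,
      FareyFib.branching (FareyFib.base (n + 1) z) = FareyFib.base n z) ∧
    (∀ (n : ℕ) (c : Fin ((FareyFib.configs n).ncard + 1) → FareyFib.Fibonadic)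
      (c' : Fin ((FareyFib.configs (n + 1)).ncard + 1) → FareyFib.Fibonadic),
      FareyFib.IsBreakpoints n c → FareyFib.IsBreakpoints (n + 1) c' →
        Set.range c ⊆ Set.range c' ∧
        ∀ (k : Fin (FareyFib.configs (n + 1)).ncard) (j : Fin (FareyFib.configs n).ncard),
        ∀ z ∈ FareyFib.principalUnits, c' k.castSucc ≤ z → z ≤ (c' k.succ).minus →
          ((FareyFib.branching (FareyFib.base (n + 1) z) = FareyFib.base n z ∧
              FareyFib.base n z = FareyFib.base n (c j.castSucc)) ↔
            Set.Icc (c' k.castSucc) (c' k.succ).minus ⊆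
              Set.Icc (c j.castSucc) (c j.succ).minus)) := by
  refine ⟨fun n => ⟨FareyFib.finite_configs n, FareyFib.existsUnique_isBreakpoints n⟩,
    fun n c hc k z hz => hc.mem_Icc_iff k hz, fun n z hz => FareyFib.branching_base n hz,
    fun n c c' hc hc' => ⟨?_, fun k j z hz h1 h2 => ?_⟩⟩
  · rw [hc.range_eq, hc'.range_eq]
    exact Set.insert_subset_insert (FareyFib.fibreMinima_subset_succ n)
  · rw [and_iff_right (FareyFib.branching_base n hz), ← hc.mem_Icc_iff j hz]
    -- On an interval of height `n + 1` the base is constant, hence so is its restriction `base n`;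
    -- one point `z` therefore decides the inclusion for the whole interval.
    refine ⟨fun h y hy => ?_, fun h => h ⟨h1, h2⟩⟩
    have hyD := hc'.mem_principalUnits_of_mem_Icc hy
    refine (hc.mem_Icc_iff j hyD).2 ?_
    rw [← FareyFib.branching_base n hyD, hc'.base_eq hyD hy, ← hc'.base_eq hz ⟨h1, h2⟩,
      FareyFib.branching_base n hz]
    exact (hc.mem_Icc_iff j hz).1 h
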